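/- Let $G$ be a group with identity $e$, let $R=\bigoplus_{\sigma\in G}R_\sigma$ be a (unital, not necessarily commutative) $G$-graded ring, let $\mathrm{Mod}(R_e)$ be the category of right $R_e$-modules, and let $\mathrm{gr}(R)$ be the category of $G$-graded unital right $R$-modules $X=\bigoplus_{\sigma\in G}X_\sigma$ (so $X_\sigma R_\tau\subseteq X_{\sigma\tau}$) with the degree-preserving $R$-linear maps as morphisms. In an abelian category, a monomorphism $f:A\to B$ is *essential* if every morphism $h:B\to P$ with $hf$ a monomorphism is a monomorphism; an epimorphism $f:A\to B$ is *superfluous* if every morphism $h:P\to A$ with $fh$ an epimorphism is an epimorphism. For objects $M,N$: - $N$ is *$M$-CS-Rickart* if for every morphism $f:M\to N$ there are an essential monomorphism $e:\mathrm{Ker}(f)\to L$ and a section (split monomorphism) $s:L\to M$ with $\ker(f)=se$, where $\ker(f):\mathrm{Ker}(f)\to M$ is the kernel of $f$; - $N$ is *dual $M$-CS-Rickart* if for every morphism $f:M\to N$ there are a retraction (split epimorphism) $r:N\to P$ and a superfluous epimorphism $t:P\to\mathrm{Coker}(f)$ with $\mathrm{coker}(f)=tr$, where $\mathrm{coker}(f):N\to\mathrm{Coker}(f)$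 is the cokernel of $f$. For a right $R_e$-module $N$, let $\mathrm{Ind}(N)$ be the graded right $R$-module $N\otimes_{R_e}R$ with components $\mathrm{Ind}(N)_\sigma=N\otimes_{R_e}R_\sigma$, and let $\mathrm{Coind}(N)$ be the graded right $R$-module $\bigoplus_{\sigma\in G}\mathrm{Coind}(N)_\sigma$ (an internal direct sum of subgroups of $\mathrm{Hom}_{R_e}(R,N)$), where $$\mathrm{Coind}(N)_\sigma=\{f\in\mathrm{Hom}_{R_e}(R,N)\mid f(R_\tau)=0\text{ for every }\tau\neq\sigma^{-1}\},$$ with $R$-action $(f\cdot r)(x)=f(rx)$. Then for all right $R_e$-modules $M$ and $N$: 1. $N$ is $M$-CS-Rickart in $\mathrm{Mod}(R_e)$ if and only if $\mathrm{Coind}(N)$ is $\mathrm{Coind}(M)$-CS-Rickart in $\mathrm{gr}(R)$. 2. $N$ is dual $M$-CS-Rickart in $\mathrm{Mod}(R_e)$ if and only if $\mathrm{Ind}(N)$ is dual $\mathrm{Ind}(M)$-CS-Rickart in $\mathrm{gr}(R)$. -/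

import Mathlib

open CategoryTheory CategoryTheory.Limits
open scoped TensorProduct

universe u v w

/-! ### Relative CS-Rickart objects -/

section CSRickart

variable {C : Type*} [Category C]

/-- A monomorphism `f : M ⟶ N` is essential if every `h : N ⟶ P` such that the composite of `f`
followed by `h` is a monomorphism is itself a monomorphism. -/
def IsEssentialMono {M N : C} (f : M ⟶ N) : Prop :=
  Mono f ∧ ∀ ⦃P : C⦄ (h : N ⟶ P), Mono (f ≫ h) → Mono h

/-- An epimorphism `f : M ⟶ N` is superfluous if every `h : P ⟶ M` such that the composite of `h`
followed by `f` is an epimorphism is itself an epimorphism. -/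
def IsSuperfluousEpi {M N : C} (f : M ⟶ N) : Prop :=
  Epi f ∧ ∀ ⦃P : C⦄ (h : P ⟶ M), Epi (h ≫ f) → Epi h

/-- `N` is `M`-CS-Rickart: for every `f : M ⟶ N`, the kernel `ker f : Ker f ⟶ M` exists and is an
essential monomorphism `e : Ker f ⟶ L` followed by a section `s : L ⟶ M`. (The kernel is given by
its universal property; any two kernels of `f` are isomorphic over `M`.) -/
def IsCSRickart [HasZeroMorphisms C] (M N : C) : Prop :=
  ∀ f : M ⟶ N, ∃ (k : KernelFork f) (_ : IsLimit k) (L : C) (e : k.pt ⟶ L) (s : L ⟶ M),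
    IsEssentialMono e ∧ IsSplitMono s ∧ Fork.ι k = e ≫ s

/-- `N` is dual `M`-CS-Rickart: for every `f : M ⟶ N`, the cokernel `coker f : N ⟶ Coker f` exists
and is a retraction `r : N ⟶ P` followed by a superfluous epimorphism `t : P ⟶ Coker f`. -/
def IsDualCSRickart [HasZeroMorphisms C] (M N : C) : Prop :=
  ∀ f : M ⟶ N, ∃ (c : CokernelCofork f) (_ : IsColimit c) (P : C) (r : N ⟶ P) (t : P ⟶ c.pt),
    IsSplitEpi r ∧ IsSuperfluousEpi t ∧ Cofork.π c = r ≫ t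

end CSRickart

/-! ### The category of graded right modules

A right module over a ring `S` is a module over the opposite ring `Sᵐᵒᵖ`. The grading group is
written additively here, as for `GradedRing`, but it is not assumed to be commutative. -/

section GradedModules

variable {ι : Type w} [DecidableEq ι] [AddGroup ι] {R : Type u} [Ring R]

/-- A graded unital right module over the graded ring `R = ⨁ σ, 𝒜 σ`. -/
structure GrMod (𝒜 : ι → AddSubgroup R) [GradedRing 𝒜] where
  /-- the underlying type -/
  carrier : Type v
  [addCommGroup : AddCommGroup carrier]
  [module : Module Rᵐᵒᵖ carrier]
  /-- the homogeneous components -/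
  grade : ι → AddSubgroup carrier
  isInternal : DirectSum.IsInternal grade
  smul_mem : ∀ ⦃σ τ : ι⦄ ⦃x : carrier⦄ ⦃r : R⦄, x ∈ grade σ → r ∈ 𝒜 τ →
    MulOpposite.op r • x ∈ grade (σ + τ)

attribute [instance] GrMod.addCommGroup GrMod.module

variable {𝒜 : ι → AddSubgroup R} [GradedRing 𝒜]

namespace GrMod

/-- Morphisms of graded right modules: `R`-linear maps that preserve degrees. -/
@[ext]
structure Hom (M N : GrMod.{u, v, w} 𝒜) where
  /-- the underlying linear map -/
  toLin : M.carrier →ₗ[Rᵐᵒᵖ] N.carrier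
  map_mem : ∀ ⦃σ : ι⦄ ⦃x : M.carrier⦄, x ∈ M.grade σ → toLin x ∈ N.grade σ

instance category : Category (GrMod.{u, v, w} 𝒜) where
  Hom := Hom
  id M := ⟨LinearMap.id, fun _ _ h => h⟩
  comp f g := ⟨g.toLin.comp f.toLin, fun _ _ h => g.map_mem (f.map_mem h)⟩

@[ext]
theorem hom_ext {M N : GrMod.{u, v, w} 𝒜} {f g : M ⟶ N} (h : f.toLin = g.toLin) : f = g :=
  Hom.ext h

@[simp]
theorem id_toLin (M : GrMod.{u, v, w} 𝒜) : Hom.toLin (𝟙 M) = LinearMap.id := rfl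

@[simp]
theorem comp_toLin {M N P : GrMod.{u, v, w} 𝒜} (f : M ⟶ N) (g : N ⟶ P) :
    (f ≫ g).toLin = g.toLin.comp f.toLin := rfl

instance {M N : GrMod.{u, v, w} 𝒜} : Zero (M ⟶ N) :=
  ⟨⟨0, fun σ _ _ => (N.grade σ).zero_mem⟩⟩

instance {M N : GrMod.{u, v, w} 𝒜} : Add (M ⟶ N) :=
  ⟨fun f g => ⟨f.toLin + g.toLin, fun σ _ h => (N.grade σ).add_mem (f.map_mem h) (g.map_mem h)⟩⟩

instance {M N : GrMod.{u, v, w} 𝒜} : Neg (M ⟶ N) :=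
  ⟨fun f => ⟨-f.toLin, fun σ _ h => (N.grade σ).neg_mem (f.map_mem h)⟩⟩

@[simp]
theorem zero_toLin {M N : GrMod.{u, v, w} 𝒜} : Hom.toLin (0 : M ⟶ N) = 0 := rfl

@[simp]
theorem add_toLin {M N : GrMod.{u, v, w} 𝒜} (f g : M ⟶ N) :
    (f + g).toLin = f.toLin + g.toLin := rfl

@[simp]
theorem neg_toLin {M N : GrMod.{u, v, w} 𝒜} (f : M ⟶ N) : (-f).toLin = -f.toLin := rfl

instance {M N : GrMod.{u, v, w} 𝒜} : AddCommGroup (M ⟶ N) where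
  add_assoc f g h := by ext1; simp [add_assoc]
  zero_add f := by ext1; simp
  add_zero f := by ext1; simp
  add_comm f g := by ext1; simp [add_comm]
  neg_add_cancel f := by ext1; simp
  nsmul := nsmulRec
  zsmul := zsmulRec

instance preadditive : Preadditive (GrMod.{u, v, w} 𝒜) where
  add_comp _ _ _ f f' g := by ext1; simp [LinearMap.comp_add]
  comp_add _ _ _ f g g' := by ext1; simp [LinearMap.add_comp]

/-- A criterion for a family of subgroups to be an internal direct sum decomposition. -/
theorem isInternal_of_separating {κ M P : Type*} [DecidableEq κ] [AddCommGroup M]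
    [AddCommGroup P] (A : κ → AddSubgroup M) (p : κ → M →+ P)
    (h₁ : ∀ σ, ∀ x ∈ A σ, p σ x = 0 → x = 0)
    (h₂ : ∀ σ τ, τ ≠ σ → ∀ x ∈ A τ, p σ x = 0)
    (h₃ : iSup A = ⊤) : DirectSum.IsInternal A := by
  classical
  constructor
  · rw [injective_iff_map_eq_zero]
    intro x hx
    ext σ
    refine h₁ σ _ (x σ).2 ?_
    rw [← map_zero (p σ), ← hx, DirectSum.coeAddMonoidHom_eq_dfinsuppSum, DFinsupp.sum, map_sum]
    by_cases hσ : σ ∈ x.support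
    · rw [Finset.sum_eq_single_of_mem σ hσ]
      exact fun τ _ hτ => h₂ σ τ hτ _ (x τ).2
    · rw [Finset.sum_eq_zero]
      · rw [DFinsupp.notMem_support_iff.mp hσ]; simp
      · intro τ hτ
        exact h₂ σ τ (fun h => hσ (h ▸ hτ)) _ (x τ).2
  · intro y
    have hy : y ∈ iSup A := h₃ ▸ AddSubgroup.mem_top y
    induction hy using AddSubgroup.iSup_induction' with
    | hp σ x hx => exact ⟨DirectSum.of (fun σ => A σ) σ ⟨x, hx⟩, by simp⟩
    | h1 => exact ⟨0, map_zero _⟩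
    | hadd x y _ _ hx hy =>
      obtain ⟨a, rfl⟩ := hx
      obtain ⟨b, rfl⟩ := hy
      exact ⟨a + b, map_add _ _ _⟩

end GrMod

/-! ### The induced functor -/

namespace GrMod

section IndObj

variable (𝒜) (N : Type v) [AddCommGroup N] [Module (𝒜 0)ᵐᵒᵖ N]

/-- The relations `(n a) ⊗ r = n ⊗ (a r)`, for `a` of degree zero. -/
def indRel : AddSubgroup (N ⊗[ℤ] R) :=
  AddSubgroup.closure {x | ∃ (n : N) (a : 𝒜 0) (r : R),
    x = (MulOpposite.op a • n) ⊗ₜ[ℤ] r - n ⊗ₜ[ℤ] ((a : R) * r)}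

/-- The abelian group `N ⊗ R`, the tensor product of a right module and a left module over the
(noncommutative) ring `𝒜 0`: additive tensor product modulo the balancing relations. -/
def IndCarrier : Type (max u v) := (N ⊗[ℤ] R) ⧸ indRel 𝒜 N

instance : AddCommGroup (IndCarrier 𝒜 N) :=
  inferInstanceAs (AddCommGroup ((N ⊗[ℤ] R) ⧸ indRel 𝒜 N))

/-- The quotient map from the additive tensor product. -/
def indQuot : N ⊗[ℤ] R →+ IndCarrier 𝒜 N := QuotientAddGroup.mk' (indRel 𝒜 N)

variable {N}

/-- The pure tensor `n ⊗ r`. -/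
def indMk (n : N) (r : R) : IndCarrier 𝒜 N := indQuot 𝒜 N (n ⊗ₜ[ℤ] r)

theorem indMk_smul (n : N) (a : 𝒜 0) (r : R) :
    indMk 𝒜 (MulOpposite.op a • n) r = indMk 𝒜 n (a * r) := by
  rw [← sub_eq_zero, indMk, indMk, ← map_sub]
  exact (QuotientAddGroup.eq_zero_iff _).mpr (AddSubgroup.subset_closure ⟨n, a, r, rfl⟩)

theorem indMk_add_left (n n' : N) (r : R) :
    indMk 𝒜 (n + n') r = indMk 𝒜 n r + indMk 𝒜 n' r := by
  simp [indMk, TensorProduct.add_tmul]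

theorem indMk_add_right (n : N) (r r' : R) :
    indMk 𝒜 n (r + r') = indMk 𝒜 n r + indMk 𝒜 n r' := by
  simp [indMk, TensorProduct.tmul_add]

@[simp]
theorem indMk_zero_left (r : R) : indMk 𝒜 (0 : N) r = 0 := by
  simp [indMk]

@[simp]
theorem indMk_zero_right (n : N) : indMk 𝒜 n 0 = 0 := by
  simp [indMk]

variable {𝒜}

theorem ind_induction {p : IndCarrier 𝒜 N → Prop} (x : IndCarrier 𝒜 N)
    (zero : p 0) (mk : ∀ n r, p (indMk 𝒜 n r)) (add : ∀ x y, p x → p y → p (x + y)) : p x := by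
  obtain ⟨x, rfl⟩ := QuotientAddGroup.mk'_surjective (indRel 𝒜 N) x
  induction x using TensorProduct.induction_on with
  | zero => exact zero
  | tmul n r => exact mk n r
  | add x y hx hy => exact add _ _ hx hy

theorem ind_hom_ext {P : Type*} [AddCommGroup P] {f g : IndCarrier 𝒜 N →+ P}
    (h : ∀ n r, f (indMk 𝒜 n r) = g (indMk 𝒜 n r)) : f = g := by
  refine AddMonoidHom.ext fun x => ?_
  induction x using ind_induction with
  | zero => rw [map_zero, map_zero]
  | mk n r => exact h n r
  | add x y hx hy => rw [map_add, map_add, hx, hy]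

variable (𝒜) in
/-- Additive maps out of `N ⊗ R` from balanced biadditive maps. -/
def indLift {P : Type*} [AddCommGroup P] (f : N →+ R →+ P)
    (hf : ∀ (n : N) (a : 𝒜 0) (r : R), f (MulOpposite.op a • n) r = f n (a * r)) :
    IndCarrier 𝒜 N →+ P :=
  QuotientAddGroup.lift (indRel 𝒜 N) (TensorProduct.liftAddHom f fun k n r => by
    rw [map_zsmul, map_zsmul, AddMonoidHom.smul_apply]) <| by
    rw [indRel, AddSubgroup.closure_le]
    rintro _ ⟨n, a, r, rfl⟩
    simp [hf]

@[simp]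
theorem indLift_mk {P : Type*} [AddCommGroup P] (f : N →+ R →+ P)
    (hf : ∀ (n : N) (a : 𝒜 0) (r : R), f (MulOpposite.op a • n) r = f n (a * r))
    (n : N) (r : R) : indLift 𝒜 f hf (indMk 𝒜 n r) = f n r := rfl

variable (𝒜 N)

/-- The biadditive map `(n, r) ↦ n ⊗ r`. -/
def indMkHom : N →+ R →+ IndCarrier 𝒜 N :=
  AddMonoidHom.mk' (fun n => AddMonoidHom.mk' (indMk 𝒜 n) (indMk_add_right 𝒜 n))
    (fun n n' => AddMonoidHom.ext (indMk_add_left 𝒜 n n'))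

@[simp]
theorem indMkHom_apply (n : N) (r : R) : indMkHom 𝒜 N n r = indMk 𝒜 n r := rfl

variable {𝒜}

/-- The additive endomorphism `n ⊗ r ↦ n ⊗ φ r`, for `φ` additive and left `𝒜 0`-linear. -/
def indMapRight (φ : R →+ R) (hφ : ∀ (a : 𝒜 0) (r : R), φ (a * r) = a * φ r) :
    IndCarrier 𝒜 N →+ IndCarrier 𝒜 N :=
  indLift 𝒜 ((AddMonoidHom.compHom' φ).comp (indMkHom 𝒜 N)) <| by
    intro n a r
    simp [indMk_smul, hφ]

@[simp]
theorem indMapRight_mk (φ : R →+ R) (hφ : ∀ (a : 𝒜 0) (r : R), φ (a * r) = a * φ r)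
    (n : N) (r : R) : indMapRight N φ hφ (indMk 𝒜 n r) = indMk 𝒜 n (φ r) := rfl

/-- The right action of `R` on `N ⊗ R`, given by `(n ⊗ r) s = n ⊗ (r s)`. -/
instance : SMul Rᵐᵒᵖ (IndCarrier 𝒜 N) :=
  ⟨fun s => indMapRight N (AddMonoidHom.mulRight s.unop) fun a r => mul_assoc (a : R) r s.unop⟩

variable {N}

@[simp]
theorem smul_indMk (s : Rᵐᵒᵖ) (n : N) (r : R) :
    s • indMk 𝒜 n r = indMk 𝒜 n (r * s.unop) := rfl

theorem ind_smul_zero (s : Rᵐᵒᵖ) : s • (0 : IndCarrier 𝒜 N) = 0 :=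
  map_zero (indMapRight N (AddMonoidHom.mulRight s.unop) _)

theorem ind_smul_add (s : Rᵐᵒᵖ) (x y : IndCarrier 𝒜 N) : s • (x + y) = s • x + s • y :=
  map_add (indMapRight N (AddMonoidHom.mulRight s.unop) _) x y

instance indModule : Module Rᵐᵒᵖ (IndCarrier 𝒜 N) where
  one_smul x := by
    induction x using ind_induction with
    | zero => rw [ind_smul_zero]
    | mk n r => simp
    | add x y hx hy => rw [ind_smul_add, hx, hy]
  mul_smul s t x := by
    induction x using ind_induction with
    | zero => simp only [ind_smul_zero]
    | mk n r => simp [mul_assoc]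
    | add x y hx hy => simp only [ind_smul_add, hx, hy]
  smul_zero := ind_smul_zero
  smul_add := ind_smul_add
  add_smul s t x := by
    induction x using ind_induction with
    | zero => simp only [ind_smul_zero, add_zero]
    | mk n r => simp [mul_add, indMk_add_right]
    | add x y hx hy => simp only [ind_smul_add, hx, hy]; abel
  zero_smul x := by
    induction x using ind_induction with
    | zero => rw [ind_smul_zero]
    | mk n r => simp
    | add x y hx hy => rw [ind_smul_add, hx, hy, add_zero]

variable (𝒜 N)

/-- The component of degree `σ` of `N ⊗ R` is (the image of) `N ⊗ 𝒜 σ`. -/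
def indGrade (σ : ι) : AddSubgroup (IndCarrier 𝒜 N) :=
  AddSubgroup.closure {x | ∃ (n : N) (r : R), r ∈ 𝒜 σ ∧ x = indMk 𝒜 n r}

/-- The projection of `R` onto the component of degree `σ`. -/
def projHom (σ : ι) : R →+ R :=
  (𝒜 σ).subtype.comp
    ((DFinsupp.evalAddMonoidHom σ).comp (DirectSum.decomposeAddEquiv 𝒜).toAddMonoidHom)

theorem projHom_apply (σ : ι) (r : R) : projHom 𝒜 σ r = (DirectSum.decompose 𝒜 r σ : R) := rfl

variable {𝒜} in
theorem projHom_same {σ : ι} {r : R} (h : r ∈ 𝒜 σ) : projHom 𝒜 σ r = r :=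
  DirectSum.decompose_of_mem_same 𝒜 h

variable {𝒜} in
theorem projHom_ne {σ τ : ι} {r : R} (h : r ∈ 𝒜 τ) (hne : τ ≠ σ) : projHom 𝒜 σ r = 0 :=
  DirectSum.decompose_of_mem_ne 𝒜 h hne

theorem projHom_zero_mul (σ : ι) (a : 𝒜 0) (r : R) :
    projHom 𝒜 σ (a * r) = a * projHom 𝒜 σ r := by
  have := DirectSum.coe_decompose_mul_add_of_left_mem (𝒜 := 𝒜) (j := σ) (b := r) a.2
  rwa [zero_add] at this

theorem indGrade_isInternal : DirectSum.IsInternal (indGrade 𝒜 N) := by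
  refine isInternal_of_separating _
    (fun σ => indMapRight N (projHom 𝒜 σ) (projHom_zero_mul 𝒜 σ)) ?_ ?_ ?_
  · intro σ x hx h0
    have key (x) (hx : x ∈ indGrade 𝒜 N σ) : indMapRight N (projHom 𝒜 σ) (projHom_zero_mul 𝒜 σ) x = x := by
      induction hx using AddSubgroup.closure_induction with
      | mem x h =>
        obtain ⟨n, r, hr, rfl⟩ := h
        simp [projHom_same hr]
      | zero => simp
      | add x y _ _ hx hy => rw [map_add, hx, hy]
      | neg x _ hx => rw [map_neg, hx]
    rw [← key x hx]
    exact h0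
  · intro σ τ hne x hx
    induction hx using AddSubgroup.closure_induction with
    | mem x h =>
      obtain ⟨n, r, hr, rfl⟩ := h
      simp [projHom_ne hr hne]
    | zero => simp
    | add x y _ _ hx hy => rw [map_add, hx, hy, add_zero]
    | neg x _ hx => rw [map_neg, hx, neg_zero]
  · rw [eq_top_iff]
    rintro x -
    induction x using ind_induction with
    | zero => exact zero_mem _
    | mk n r =>
      induction r using DirectSum.Decomposition.inductionOn 𝒜 with
      | zero => simp
      | homogeneous m =>
        exact AddSubgroup.mem_iSup_of_mem _ (AddSubgroup.subset_closure ⟨n, _, m.2, rfl⟩)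
      | add r r' h h' => rw [indMk_add_right]; exact add_mem h h'
    | add x y hx hy => exact add_mem hx hy

theorem indGrade_smul_mem {σ τ : ι} {x : IndCarrier 𝒜 N} {s : R}
    (hx : x ∈ indGrade 𝒜 N σ) (hs : s ∈ 𝒜 τ) :
    MulOpposite.op s • x ∈ indGrade 𝒜 N (σ + τ) := by
  induction hx using AddSubgroup.closure_induction with
  | mem x h =>
    obtain ⟨n, r, hr, rfl⟩ := h
    rw [smul_indMk]
    exact AddSubgroup.subset_closure ⟨n, _, SetLike.mul_mem_graded hr hs, rfl⟩
  | zero => simp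
  | add x y _ _ hx hy => rw [smul_add]; exact add_mem hx hy
  | neg x _ hx => rw [smul_neg]; exact neg_mem hx

variable {M N : Type v} [AddCommGroup M] [Module (𝒜 0)ᵐᵒᵖ M] [AddCommGroup N]
  [Module (𝒜 0)ᵐᵒᵖ N]

/-- The map `g ⊗ R : M ⊗ R → N ⊗ R`. -/
def indMap (g : M →ₗ[(𝒜 0)ᵐᵒᵖ] N) : IndCarrier 𝒜 M →ₗ[Rᵐᵒᵖ] IndCarrier 𝒜 N where
  __ := indLift 𝒜 ((indMkHom 𝒜 N).comp g.toAddMonoidHom) (fun n a r => by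
    simp [indMk_smul])
  map_smul' s x := by
    change indLift 𝒜 _ _ (s • x) = s • indLift 𝒜 _ _ x
    induction x using ind_induction with
    | zero => rw [smul_zero, map_zero, smul_zero]
    | mk n r => rfl
    | add x y hx hy => rw [smul_add, map_add, hx, hy, map_add, smul_add]

@[simp]
theorem indMap_mk (g : M →ₗ[(𝒜 0)ᵐᵒᵖ] N) (m : M) (r : R) :
    indMap 𝒜 g (indMk 𝒜 m r) = indMk 𝒜 (g m) r := rfl

theorem ind_linearMap_ext {P : Type*} [AddCommGroup P] [Module Rᵐᵒᵖ P]
    {f g : IndCarrier 𝒜 N →ₗ[Rᵐᵒᵖ] P}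
    (h : ∀ n r, f (indMk 𝒜 n r) = g (indMk 𝒜 n r)) : f = g :=
  LinearMap.toAddMonoidHom_injective (ind_hom_ext h)

theorem indMap_mem (g : M →ₗ[(𝒜 0)ᵐᵒᵖ] N) {σ : ι} {x : IndCarrier 𝒜 M}
    (hx : x ∈ indGrade 𝒜 M σ) : indMap 𝒜 g x ∈ indGrade 𝒜 N σ := by
  induction hx using AddSubgroup.closure_induction with
  | mem x h =>
    obtain ⟨n, r, hr, rfl⟩ := h
    exact AddSubgroup.subset_closure ⟨g n, r, hr, rfl⟩
  | zero => simp
  | add x y _ _ hx hy => rw [map_add]; exact add_mem hx hy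
  | neg x _ hx => rw [map_neg]; exact neg_mem hx

end IndObj

/-- The induced functor `Ind`, sending a right `𝒜 0`-module `N` to the graded right `R`-module
`N ⊗ R` with components `N ⊗ 𝒜 σ`. -/
def Ind (𝒜 : ι → AddSubgroup R) [GradedRing 𝒜] :
    ModuleCat.{max u v} (𝒜 0)ᵐᵒᵖ ⥤ GrMod.{u, max u v, w} 𝒜 where
  obj N :=
    { carrier := IndCarrier 𝒜 N
      grade := indGrade 𝒜 N
      isInternal := indGrade_isInternal 𝒜 N
      smul_mem := fun _ _ _ _ => indGrade_smul_mem 𝒜 N }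
  map g := ⟨indMap 𝒜 g.hom, fun _ _ h => indMap_mem 𝒜 g.hom h⟩
  map_id _ := hom_ext (ind_linearMap_ext 𝒜 fun _ _ => rfl)
  map_comp _ _ := hom_ext (ind_linearMap_ext 𝒜 fun _ _ => rfl)

/-! ### The coinduced functor -/

section CoindObj

variable (𝒜) (N : Type v) [AddCommGroup N] [Module (𝒜 0)ᵐᵒᵖ N]

/-- The group of all right `𝒜 0`-linear maps `f : R → N` such that `f` vanishes on `𝒜 τ` for
every `τ ≠ -σ`. -/
def coindPart (σ : ι) : AddSubgroup (R →+ N) where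
  carrier := {f | (∀ (r : R) (a : 𝒜 0), f (r * a) = MulOpposite.op a • f r) ∧
    ∀ τ, τ ≠ -σ → ∀ r ∈ 𝒜 τ, f r = 0}
  zero_mem' := by simp
  add_mem' {f g} hf hg := by
    refine ⟨fun r a => ?_, fun τ hτ r hr => ?_⟩
    · simp [hf.1, hg.1]
    · simp [hf.2 τ hτ r hr, hg.2 τ hτ r hr]
  neg_mem' {f} hf := by
    refine ⟨fun r a => ?_, fun τ hτ r hr => ?_⟩
    · simp [hf.1]
    · simp [hf.2 τ hτ r hr]

/-- The sum of the groups `coindPart 𝒜 N σ` inside the group of additive maps `R → N`. -/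
def coindSubgroup : AddSubgroup (R →+ N) := ⨆ σ, coindPart 𝒜 N σ

variable {𝒜 N}

theorem comp_mulLeft_mem_part {σ τ : ι} {f : R →+ N} (hf : f ∈ coindPart 𝒜 N σ) {s : R}
    (hs : s ∈ 𝒜 τ) : f.comp (AddMonoidHom.mulLeft s) ∈ coindPart 𝒜 N (σ + τ) := by
  refine ⟨fun r a => ?_, fun ρ hρ r hr => ?_⟩
  · simp [← mul_assoc, hf.1]
  · refine hf.2 (τ + ρ) (fun h => hρ ?_) _ (SetLike.mul_mem_graded hs hr)
    rw [neg_add_rev, ← h, neg_add_cancel_left]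

theorem comp_mulLeft_mem {f : R →+ N} (hf : f ∈ coindSubgroup 𝒜 N) (s : R) :
    f.comp (AddMonoidHom.mulLeft s) ∈ coindSubgroup 𝒜 N := by
  induction hf using AddSubgroup.iSup_induction' with
  | hp σ f hf =>
    induction s using DirectSum.Decomposition.inductionOn 𝒜 with
    | zero =>
      convert zero_mem (coindSubgroup 𝒜 N)
      ext; simp
    | homogeneous m => exact AddSubgroup.mem_iSup_of_mem _ (comp_mulLeft_mem_part hf m.2)
    | add r r' h h' =>
      convert add_mem h h'
      ext; simp [add_mul]
  | h1 => exact zero_mem (coindSubgroup 𝒜 N)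
  | hadd f g _ _ hf hg => exact add_mem hf hg

variable (𝒜 N)

/-- The underlying group of the coinduced module. -/
def CoindCarrier : Type (max u v) := coindSubgroup 𝒜 N

instance : AddCommGroup (CoindCarrier 𝒜 N) := inferInstanceAs (AddCommGroup (coindSubgroup 𝒜 N))

/-- The inclusion of the coinduced module into the group of additive maps `R → N`. -/
def coindVal : CoindCarrier 𝒜 N →+ (R →+ N) := (coindSubgroup 𝒜 N).subtype

variable {𝒜 N}

theorem coindVal_injective : Function.Injective (coindVal 𝒜 N) := Subtype.val_injective

@[ext]
theorem coind_ext {f g : CoindCarrier 𝒜 N} (h : ∀ r, coindVal 𝒜 N f r = coindVal 𝒜 N g r) :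
    f = g :=
  coindVal_injective (AddMonoidHom.ext h)

/-- The right action of `R` on the coinduced module, given by `(f s) r = f (s r)`. -/
instance : SMul Rᵐᵒᵖ (CoindCarrier 𝒜 N) :=
  ⟨fun s f => ⟨(coindVal 𝒜 N f).comp (AddMonoidHom.mulLeft s.unop), comp_mulLeft_mem f.2 _⟩⟩

@[simp]
theorem coindVal_smul (s : Rᵐᵒᵖ) (f : CoindCarrier 𝒜 N) (r : R) :
    coindVal 𝒜 N (s • f) r = coindVal 𝒜 N f (s.unop * r) := rfl

instance coindModule : Module Rᵐᵒᵖ (CoindCarrier 𝒜 N) where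
  one_smul f := by ext; simp
  mul_smul s t f := by ext; simp [mul_assoc]
  smul_zero s := by ext; simp
  smul_add s f g := by ext; simp
  add_smul s t f := by ext; simp [add_mul]
  zero_smul f := by ext; simp

variable (𝒜 N)

/-- The component of degree `σ` of the coinduced module. -/
def coindGrade (σ : ι) : AddSubgroup (CoindCarrier 𝒜 N) :=
  (coindPart 𝒜 N σ).comap (coindVal 𝒜 N)

theorem coindGrade_isInternal : DirectSum.IsInternal (coindGrade 𝒜 N) := by
  refine isInternal_of_separating (P := R →+ N) _
    (fun σ => (AddMonoidHom.compHom' (projHom 𝒜 (-σ))).comp (coindVal 𝒜 N)) ?_ ?_ ?_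
  · intro σ f hf h0
    ext r
    induction r using DirectSum.Decomposition.inductionOn 𝒜 with
    | zero => simp
    | @homogeneous τ m =>
      by_cases hτ : τ = -σ
      · subst hτ
        have := DFunLike.congr_fun h0 (m : R)
        simpa [projHom_same m.2] using this
      · simpa using hf.2 τ hτ m m.2
    | add r r' h h' => simp_all
  · intro σ τ hne f hf
    ext r
    refine hf.2 (-σ) (fun h => hne (neg_injective h).symm) _ ?_
    exact (DirectSum.decompose 𝒜 r (-σ)).2
  · rw [eq_top_iff]
    rintro ⟨f, hf⟩ -
    induction hf using AddSubgroup.iSup_induction' with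
    | hp σ f hf => exact AddSubgroup.mem_iSup_of_mem σ hf
    | h1 => exact zero_mem _
    | hadd f g _ _ hf hg => exact add_mem hf hg

variable {M N : Type v} [AddCommGroup M] [Module (𝒜 0)ᵐᵒᵖ M] [AddCommGroup N]
  [Module (𝒜 0)ᵐᵒᵖ N]

theorem comp_mem_coindPart (g : M →ₗ[(𝒜 0)ᵐᵒᵖ] N) {σ : ι} {f : R →+ M}
    (hf : f ∈ coindPart 𝒜 M σ) : g.toAddMonoidHom.comp f ∈ coindPart 𝒜 N σ := by
  refine ⟨fun r a => ?_, fun τ hτ r hr => ?_⟩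
  · simp [hf.1]
  · simp [hf.2 τ hτ r hr]

theorem comp_mem_coindSubgroup (g : M →ₗ[(𝒜 0)ᵐᵒᵖ] N) {f : R →+ M}
    (hf : f ∈ coindSubgroup 𝒜 M) : g.toAddMonoidHom.comp f ∈ coindSubgroup 𝒜 N := by
  induction hf using AddSubgroup.iSup_induction' with
  | hp σ f hf => exact AddSubgroup.mem_iSup_of_mem _ (comp_mem_coindPart 𝒜 g hf)
  | h1 => rw [AddMonoidHom.comp_zero]; exact zero_mem _
  | hadd f f' _ _ hf hf' => rw [AddMonoidHom.comp_add]; exact add_mem hf hf'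

/-- The map `f ↦ g ∘ f` between coinduced modules. -/
def coindMap (g : M →ₗ[(𝒜 0)ᵐᵒᵖ] N) : CoindCarrier 𝒜 M →ₗ[Rᵐᵒᵖ] CoindCarrier 𝒜 N where
  toFun f := ⟨g.toAddMonoidHom.comp (coindVal 𝒜 M f), comp_mem_coindSubgroup 𝒜 g f.2⟩
  map_add' _ _ := coind_ext fun _ => map_add g _ _
  map_smul' _ _ := rfl

end CoindObj

/-- The coinduced functor `Coind`, sending a right `𝒜 0`-module `N` to the graded right `R`-module
whose component of degree `σ` is the group of right `𝒜 0`-linear maps `f : R → N` vanishing on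
`𝒜 τ` for every `τ ≠ -σ`. -/
def Coind (𝒜 : ι → AddSubgroup R) [GradedRing 𝒜] :
    ModuleCat.{max u v} (𝒜 0)ᵐᵒᵖ ⥤ GrMod.{u, max u v, w} 𝒜 where
  obj N :=
    { carrier := CoindCarrier 𝒜 N
      grade := coindGrade 𝒜 N
      isInternal := coindGrade_isInternal 𝒜 N
      smul_mem := fun _ _ _ _ hf hs => comp_mulLeft_mem_part hf hs }
  map g := ⟨coindMap 𝒜 g.hom, fun _ _ h => comp_mem_coindPart 𝒜 g.hom h⟩
  map_id _ := rfl
  map_comp _ _ := rfl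

end GrMod

end GradedModules

/-!
The functor `X ↦ X₀` taking the component of degree zero of a graded module sits in an adjoint
triple `Ind ⊣ (-)₀ ⊣ Coind` (`GrMod.indAdjunction`, `GrMod.coindAdjunction`). A map `g : N → X₀`
corresponds to `n ⊗ r ↦ g(n) r`, and a map `g : X₀ → N` to `x ↦ (r ↦ g((x r)₀))`. The counit
`Coind(N)₀ → N` is evaluation at `1` and is bijective, so `Coind` is fully faithful, and hence so is
`Ind`. Having adjoints on both sides, `(-)₀` preserves monomorphisms and epimorphisms.

The first equivalence then holds for every fully faithful functor `G : C ⥤ D` with a left adjoint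
`F` preserving monomorphisms, provided that `C` has kernels (`isCSRickart_map_iff`):

* every map `G M ⟶ G N` is of the form `G f`, and `G` preserves kernels and sections;
* `G` preserves essential monomorphisms (`IsEssentialMono.map_of_adjunction`), which moves a
  factorization of `ker f` from `C` to `D`;
* in a factorization of `ker (G f)` through a section `L ⟶ G M`, the object `L` is a retract of
  `G M`, so that the unit `L ⟶ G F L` is an isomorphism (`isIso_unit_app_of_isSplitMono`). The whole
  factorization is therefore the image of one in `C`, and `G` reflects essential monomorphisms
  (`IsEssentialMono.of_map_of_adjunction`).

The second equivalence is the first one for the opposite categories (`isDualCSRickart_iff_op`),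
applied to the adjunction `Ind ⊣ (-)₀`.
-/

section CSRickart

variable {C D : Type*} [Category C] [Category D]

/-! ### Essential monomorphisms and fully faithful right adjoints -/

theorem IsEssentialMono.iso_comp_iso {K L K' L' : C} {e : K ⟶ L} (he : IsEssentialMono e)
    (i : K' ≅ K) (j : L ≅ L') : IsEssentialMono (i.hom ≫ e ≫ j.hom) := by
  have := he.1
  refine ⟨inferInstance, fun P h hh => ?_⟩
  have : Mono (e ≫ j.hom ≫ h) := by
    have : e ≫ j.hom ≫ h = i.inv ≫ (i.hom ≫ e ≫ j.hom) ≫ h := by simp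
    rw [this]
    infer_instance
  have := he.2 _ this
  rw [← j.inv_hom_id_assoc h]
  infer_instance

section Adjunction

variable {F : D ⥤ C} {G : C ⥤ D}

/-- A fully faithful right adjoint of a functor preserving monomorphisms preserves essential
monomorphisms: if `G e ≫ h` is a monomorphism then so is `e ≫ h'`, where `h' : L ⟶ F P` is the
map obtained from `F h` and the isomorphism `F G L ≅ L`; hence `h'` is a monomorphism, and so is
`G h'`, which is `h` followed by the unit at `P`. -/
theorem IsEssentialMono.map_of_adjunction (adj : F ⊣ G) [G.Full] [G.Faithful]
    [F.PreservesMonomorphisms] {K L : C} {e : K ⟶ L} (he : IsEssentialMono e) :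
    IsEssentialMono (G.map e) := by
  have := G.preservesMonomorphisms_of_adjunction adj
  have := he.1
  refine ⟨inferInstance, fun P h hh => ?_⟩
  have hF : Mono (e ≫ inv (adj.counit.app L) ≫ F.map h) := by
    have : e ≫ inv (adj.counit.app L) ≫ F.map h =
        inv (adj.counit.app K) ≫ F.map (G.map e ≫ h) := by
      rw [IsIso.eq_inv_comp, F.map_comp, ← adj.counit_naturality_assoc, IsIso.hom_inv_id_assoc]
    rw [this]
    infer_instance
  have := he.2 _ hF
  have hG : G.map (inv (adj.counit.app L) ≫ F.map h) = h ≫ adj.unit.app P := by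
    rw [G.map_comp, Functor.map_inv, IsIso.inv_comp_eq, ← cancel_epi (adj.unit.app (G.obj L)),
      adj.right_triangle_components_assoc]
    exact (adj.unit.naturality h).symm
  have : Mono (h ≫ adj.unit.app P) := hG ▸ inferInstance
  exact mono_of_mono h (adj.unit.app P)

theorem IsEssentialMono.of_map_of_adjunction (adj : F ⊣ G) [G.Faithful] {K L : C} {e : K ⟶ L}
    (he : IsEssentialMono (G.map e)) : IsEssentialMono e := by
  have := G.preservesMonomorphisms_of_adjunction adj
  refine ⟨G.mono_of_mono_map he.1, fun P h hh => G.mono_of_mono_map (he.2 _ ?_)⟩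
  rw [← G.map_comp]
  infer_instance

/-- The essential image of a fully faithful right adjoint is closed under retracts. -/
theorem isIso_unit_app_of_isSplitMono (adj : F ⊣ G) [G.Full] [G.Faithful] {L : D} {M : C}
    (s : L ⟶ G.obj M) [IsSplitMono s] : IsIso (adj.unit.app L) := by
  let r : RetractArrow (adj.unit.app L) (adj.unit.app (G.obj M)) :=
    { i := Arrow.homMk s (G.map (F.map s)) (adj.unit_naturality s).symm
      r := Arrow.homMk (retraction s) (G.map (F.map (retraction s)))
        (adj.unit_naturality (retraction s)).symm
      retract := by ext <;> simp [← Functor.map_comp] }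
  exact (MorphismProperty.isomorphisms D).of_retract r
    (.infer_property (adj.unit.app (G.obj M)))

variable [HasZeroMorphisms C] [HasZeroMorphisms D]

theorem isCSRickart_map_iff (adj : F ⊣ G) [G.Full] [G.Faithful] [F.PreservesMonomorphisms]
    [HasKernels C] (M N : C) :
    IsCSRickart (G.obj M) (G.obj N) ↔ IsCSRickart M N := by
  have := adj.isRightAdjoint
  have : PreservesLimitsOfSize.{0, 0} G := adj.rightAdjoint_preservesLimits
  constructor
  · intro H f
    obtain ⟨k, hk, L, e, s, he, hs, hes⟩ := H (G.map f)
    have := isIso_unit_app_of_isSplitMono adj s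
    let i : G.obj (kernel f) ≅ k.pt :=
      ((KernelFork.mapIsLimit _ (kernelIsKernel f) G).conePointUniqueUpToIso hk)
    have hi : i.hom ≫ Fork.ι k = G.map (kernel.ι f) :=
      IsLimit.conePointUniqueUpToIso_hom_comp _ hk WalkingParallelPair.zero
    let j : L ≅ G.obj (F.obj L) := asIso (adj.unit.app L)
    refine ⟨_, kernelIsKernel f, F.obj L, G.preimage (i.hom ≫ e ≫ j.hom),
      G.preimage (j.inv ≫ s), .of_map_of_adjunction adj ?_, ?_, G.map_injective ?_⟩
    · rw [G.map_preimage]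
      exact he.iso_comp_iso i j
    · refine ⟨⟨⟨G.preimage (retraction s ≫ j.hom), G.map_injective ?_⟩⟩⟩
      simp
    · rw [G.map_comp, G.map_preimage, G.map_preimage]
      simpa [← hes] using hi.symm
  · intro H f
    obtain ⟨f, rfl⟩ := G.map_surjective f
    obtain ⟨k, hk, L, e, s, he, hs, hes⟩ := H f
    refine ⟨_, KernelFork.mapIsLimit k hk G, G.obj L, G.map e, G.map s,
      he.map_of_adjunction adj, inferInstance, ?_⟩
    exact (congrArg G.map hes).trans (G.map_comp e s)

end Adjunction

/-! ### Duality -/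

theorem isSuperfluousEpi_iff_op {M N : C} (f : M ⟶ N) :
    IsSuperfluousEpi f ↔ IsEssentialMono f.op := by
  constructor
  · rintro ⟨hf, h⟩
    refine ⟨inferInstance, fun P g hg => ?_⟩
    have : Epi (g.unop ≫ f) := inferInstanceAs (Epi (f.op ≫ g).unop)
    have := h g.unop this
    exact inferInstanceAs (Mono g.unop.op)
  · rintro ⟨hf, h⟩
    refine ⟨inferInstanceAs (Epi f.op.unop), fun P g hg => ?_⟩
    have : Mono (f.op ≫ g.op) := inferInstanceAs (Mono (g ≫ f).op)
    have := h g.op this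
    exact inferInstanceAs (Epi g.op.unop)

theorem isDualCSRickart_iff_op [HasZeroMorphisms C] (M N : C) :
    IsDualCSRickart M N ↔ IsCSRickart (Opposite.op N) (Opposite.op M) := by
  constructor
  · intro H f
    obtain ⟨c, hc, P, r, t, hr, ht, hrt⟩ := H f.unop
    exact ⟨_, CokernelCofork.IsColimit.ofπOp c.π c.condition
      (IsColimit.ofIsoColimit hc (Cofork.isoCoforkOfπ c)), _, t.op, r.op,
      (isSuperfluousEpi_iff_op t).mp ht, inferInstance, congrArg Quiver.Hom.op hrt⟩
  · intro H f
    obtain ⟨k, hk, L, e, s, he, hs, hes⟩ := H f.op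
    exact ⟨_, KernelFork.IsLimit.ofιUnop k.ι k.condition
      (IsLimit.ofIsoLimit hk (Fork.isoForkOfι k)), _, s.unop, e.unop,
      ⟨⟨(retraction s).unop, congrArg Quiver.Hom.unop (IsSplitMono.id s)⟩⟩, (isSuperfluousEpi_iff_op e.unop).mpr he, congrArg Quiver.Hom.unop hes⟩

theorem isDualCSRickart_map_iff [HasZeroMorphisms C] [HasZeroMorphisms D]
    {F : C ⥤ D} {G : D ⥤ C} (adj : F ⊣ G) [F.Full] [F.Faithful] [G.PreservesEpimorphisms]
    [HasCokernels C] (M N : C) :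
    IsDualCSRickart (F.obj M) (F.obj N) ↔ IsDualCSRickart M N := by
  have : G.op.PreservesMonomorphisms := ⟨fun f _ => inferInstanceAs (Mono (G.map f.unop).op)⟩
  have : HasKernels Cᵒᵖ :=
    ⟨fun f => ⟨⟨⟨_, CokernelCofork.IsColimit.ofπOp _ (cokernel.condition _) (cokernelIsCokernel f.unop)⟩⟩⟩⟩
  rw [isDualCSRickart_iff_op, isDualCSRickart_iff_op]
  exact isCSRickart_map_iff adj.op _ _

end CSRickart

universe w'

section GradedModules

variable {ι : Type w} [DecidableEq ι] [AddGroup ι] {R : Type u} [Ring R]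
variable {𝒜 : ι → AddSubgroup R} [GradedRing 𝒜]

namespace GrMod

/-! ### Homogeneous components -/

/-- The additive projection of a graded module onto its component of degree `σ`. -/
noncomputable def gradeProj (X : GrMod.{u, v, w} 𝒜) (σ : ι) : X.carrier →+ X.grade σ :=
  letI := X.isInternal.chooseDecomposition
  (DFinsupp.evalAddMonoidHom σ).comp (DirectSum.decomposeAddEquiv X.grade).toAddMonoidHom

variable {X Y : GrMod.{u, v, w} 𝒜}

theorem gradeProj_same {σ : ι} {x : X.carrier} (hx : x ∈ X.grade σ) :
    (X.gradeProj σ x : X.carrier) = x :=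
  letI := X.isInternal.chooseDecomposition
  DirectSum.decompose_of_mem_same X.grade hx

theorem gradeProj_ne {σ τ : ι} {x : X.carrier} (hx : x ∈ X.grade τ) (h : τ ≠ σ) :
    X.gradeProj σ x = 0 :=
  letI := X.isInternal.chooseDecomposition
  Subtype.ext (DirectSum.decompose_of_mem_ne X.grade hx h)

theorem homogeneous_induction {p : X.carrier → Prop} (x : X.carrier) (zero : p 0)
    (homogeneous : ∀ σ, ∀ x ∈ X.grade σ, p x) (add : ∀ x y, p x → p y → p (x + y)) : p x :=
  letI := X.isInternal.chooseDecomposition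
  DirectSum.Decomposition.inductionOn X.grade zero (fun m => homogeneous _ _ m.2) add x

theorem map_gradeProj (f : X ⟶ Y) (σ : ι) (x : X.carrier) :
    f.toLin (X.gradeProj σ x) = Y.gradeProj σ (f.toLin x) := by
  induction x using homogeneous_induction with
  | zero => simp
  | homogeneous τ x hx =>
    by_cases h : τ = σ
    · subst h
      rw [gradeProj_same hx, gradeProj_same (f.map_mem hx)]
    · rw [gradeProj_ne hx h, gradeProj_ne (f.map_mem hx) h]
      simp
  | add x y hx hy => simp [hx, hy]

theorem smul_mem_grade {σ : ι} {x : X.carrier} (hx : x ∈ X.grade σ) (a : 𝒜 0) :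
    MulOpposite.op (a : R) • x ∈ X.grade σ := by
  simpa using X.smul_mem hx a.2

theorem gradeProj_smul_zero (σ : ι) (a : 𝒜 0) (x : X.carrier) :
    (X.gradeProj σ (MulOpposite.op (a : R) • x) : X.carrier) =
      MulOpposite.op (a : R) • (X.gradeProj σ x : X.carrier) := by
  induction x using homogeneous_induction with
  | zero => simp
  | homogeneous τ x hx =>
    by_cases h : τ = σ
    · subst h
      rw [gradeProj_same hx, gradeProj_same (smul_mem_grade hx a)]
    · rw [gradeProj_ne hx h, gradeProj_ne (smul_mem_grade hx a) h]
      simp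
  | add x y hx hy => simp [hx, hy]

/-! ### The functor taking the component of degree zero -/

/-- The component of degree zero of a graded right `R`-module is a right `𝒜 0`-module. -/
instance gradeZeroModule (X : GrMod.{u, v, w} 𝒜) : Module (𝒜 0)ᵐᵒᵖ (X.grade 0) where
  smul a x := ⟨MulOpposite.op (a.unop : R) • (x : X.carrier), smul_mem_grade x.2 a.unop⟩
  one_smul x := Subtype.ext (one_smul Rᵐᵒᵖ (x : X.carrier))
  mul_smul a b x := Subtype.ext
    (mul_smul (MulOpposite.op (a.unop : R)) (MulOpposite.op (b.unop : R)) (x : X.carrier))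
  smul_zero _ := Subtype.ext (smul_zero _)
  smul_add _ _ _ := Subtype.ext (smul_add _ _ _)
  add_smul a b x := Subtype.ext
    (add_smul (MulOpposite.op (a.unop : R)) (MulOpposite.op (b.unop : R)) (x : X.carrier))
  zero_smul x := Subtype.ext (zero_smul Rᵐᵒᵖ (x : X.carrier))

@[simp]
theorem coe_gradeZero_smul (a : (𝒜 0)ᵐᵒᵖ) (x : X.grade 0) :
    ((a • x : X.grade 0) : X.carrier) = MulOpposite.op (a.unop : R) • (x : X.carrier) := rfl

/-- The `𝒜 0`-linear map between the components of degree zero induced by a morphism of graded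
modules. -/
def gradeZeroMap (f : X ⟶ Y) : X.grade 0 →ₗ[(𝒜 0)ᵐᵒᵖ] Y.grade 0 where
  toFun x := ⟨f.toLin x, f.map_mem x.2⟩
  map_add' _ _ := Subtype.ext (map_add f.toLin _ _)
  map_smul' a x := Subtype.ext (map_smul f.toLin (MulOpposite.op (a.unop : R)) (x : X.carrier))

/-- The functor sending a graded right `R`-module to its component of degree zero. -/
def gradeZero (𝒜 : ι → AddSubgroup R) [GradedRing 𝒜] :
    GrMod.{u, v, w} 𝒜 ⥤ ModuleCat.{v} (𝒜 0)ᵐᵒᵖ where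
  obj X := ModuleCat.of _ (X.grade 0)
  map f := ModuleCat.ofHom (gradeZeroMap f)
  map_id _ := rfl
  map_comp _ _ := rfl

/-! ### The induced functor is left adjoint to the component of degree zero -/

section Ind

variable {N : Type v} [AddCommGroup N] [Module (𝒜 0)ᵐᵒᵖ N]

theorem indMk_mem_indGrade (n : N) {σ : ι} {r : R} (hr : r ∈ 𝒜 σ) :
    indMk 𝒜 n r ∈ indGrade 𝒜 N σ :=
  AddSubgroup.subset_closure ⟨n, r, hr, rfl⟩

/-- The map `n ↦ n ⊗ 1` from `N` to the component of degree zero of `N ⊗ R`. -/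
def indUnit (N : ModuleCat.{max u v} (𝒜 0)ᵐᵒᵖ) :
    N →ₗ[(𝒜 0)ᵐᵒᵖ] ((Ind.{u, v, w} 𝒜).obj N).grade 0 where
  toFun n := ⟨indMk 𝒜 n 1, indMk_mem_indGrade n SetLike.GradedOne.one_mem⟩
  map_add' n n' := Subtype.ext (indMk_add_left 𝒜 n n' 1)
  map_smul' a n := Subtype.ext <| by
    refine (indMk_smul 𝒜 n a.unop 1).trans ?_
    rw [mul_one, ← one_mul (a.unop : R)]
    rfl

/-- The additive map `n ⊗ r ↦ g(n) r` determined by a map `g : N → X₀`. -/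
def indDescHom {X : GrMod.{u, w', w} 𝒜} (g : N →ₗ[(𝒜 0)ᵐᵒᵖ] X.grade 0) :
    IndCarrier 𝒜 N →+ X.carrier :=
  indLift 𝒜 (AddMonoidHom.mk'
    (fun n => AddMonoidHom.mk' (fun r => MulOpposite.op r • (g n : X.carrier))
      fun r r' => by rw [MulOpposite.op_add, add_smul])
    fun n n' => AddMonoidHom.ext fun r => by
      change MulOpposite.op r • (g (n + n') : X.carrier) = MulOpposite.op r • (g n : X.carrier) +
        MulOpposite.op r • (g n' : X.carrier)
      rw [map_add, AddSubgroup.coe_add, smul_add])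
    fun n a r => by
      change MulOpposite.op r • (g (MulOpposite.op a • n) : X.carrier) =
        MulOpposite.op ((a : R) * r) • (g n : X.carrier)
      rw [map_smul, coe_gradeZero_smul, MulOpposite.op_mul, mul_smul, MulOpposite.unop_op]

theorem indDescHom_mk {X : GrMod.{u, w', w} 𝒜} (g : N →ₗ[(𝒜 0)ᵐᵒᵖ] X.grade 0) (n : N) (r : R) :
    indDescHom g (indMk 𝒜 n r) = MulOpposite.op r • (g n : X.carrier) := rfl

theorem indDescHom_smul {X : GrMod.{u, w', w} 𝒜} (g : N →ₗ[(𝒜 0)ᵐᵒᵖ] X.grade 0) (s : Rᵐᵒᵖ)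
    (x : IndCarrier 𝒜 N) : indDescHom g (s • x) = s • indDescHom g x := by
  induction x using ind_induction with
  | zero => rw [smul_zero, map_zero, smul_zero]
  | mk n r =>
    rw [smul_indMk, indDescHom_mk, indDescHom_mk, MulOpposite.op_mul, mul_smul,
      MulOpposite.op_unop]
  | add x y hx hy => rw [smul_add, map_add, hx, hy, map_add, smul_add]

theorem indDescHom_mem {X : GrMod.{u, w', w} 𝒜} (g : N →ₗ[(𝒜 0)ᵐᵒᵖ] X.grade 0) {σ : ι}
    {x : IndCarrier 𝒜 N} (hx : x ∈ indGrade 𝒜 N σ) : indDescHom g x ∈ X.grade σ := by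
  induction hx using AddSubgroup.closure_induction with
  | mem x h =>
    obtain ⟨n, r, hr, rfl⟩ := h
    have := X.smul_mem (g n).2 hr
    rwa [zero_add] at this
  | zero => rw [map_zero]; exact zero_mem _
  | add x y _ _ hx hy => rw [map_add]; exact add_mem hx hy
  | neg x _ hx => rw [map_neg]; exact neg_mem hx

/-- The morphism `n ⊗ r ↦ g(n) r` of graded modules determined by a map `g : N → X₀`. -/
def indDesc {N : ModuleCat.{max u v} (𝒜 0)ᵐᵒᵖ} {X : GrMod.{u, max u v, w} 𝒜}
    (g : N →ₗ[(𝒜 0)ᵐᵒᵖ] X.grade 0) : (Ind.{u, v, w} 𝒜).obj N ⟶ X where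
  toLin :=
    { __ := indDescHom g
      map_smul' := indDescHom_smul g }
  map_mem _ _ hx := indDescHom_mem g hx

theorem indDesc_mk {N : ModuleCat.{max u v} (𝒜 0)ᵐᵒᵖ} {X : GrMod.{u, max u v, w} 𝒜}
    (g : N →ₗ[(𝒜 0)ᵐᵒᵖ] X.grade 0) (n : N) (r : R) :
    (indDesc g).toLin (indMk 𝒜 n r) = MulOpposite.op r • (g n : X.carrier) := rfl

/-- The adjunction between the induced functor and the functor taking the component of degree
zero. -/
def indAdjunction (𝒜 : ι → AddSubgroup R) [GradedRing 𝒜] :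
    Ind.{u, v, w} 𝒜 ⊣ gradeZero.{u, max u v, w} 𝒜 :=
  Adjunction.mkOfHomEquiv
    { homEquiv := fun N X =>
        { toFun := fun f => ModuleCat.ofHom ((gradeZeroMap f).comp (indUnit N))
          invFun := fun g => indDesc g.hom
          left_inv := fun f => hom_ext <| ind_linearMap_ext 𝒜 fun n r => by
            refine (indDesc_mk _ n r).trans ((map_smul f.toLin _ _).symm.trans ?_)
            exact congrArg (fun t => f.toLin (indMk 𝒜 n t)) (one_mul r)
          right_inv := fun g => ModuleCat.hom_ext <| LinearMap.ext fun n =>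
            Subtype.ext (one_smul Rᵐᵒᵖ (show X.grade 0 from g.hom n).1) }
      homEquiv_naturality_left_symm := fun f g =>
        hom_ext <| ind_linearMap_ext 𝒜 fun n r => rfl
      homEquiv_naturality_right := fun f g => rfl }

end Ind

/-! ### The coinduced functor is right adjoint to the component of degree zero -/

section Coind

/-- Evaluation at `1`, as a map from the component of degree zero of the coinduced module. -/
def coindCounit (N : ModuleCat.{max u v} (𝒜 0)ᵐᵒᵖ) :
    ((Coind.{u, v, w} 𝒜).obj N).grade 0 →ₗ[(𝒜 0)ᵐᵒᵖ] N where
  toFun f := coindVal 𝒜 N f.1 1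
  map_add' _ _ := rfl
  map_smul' a f := by
    refine Eq.trans ?_ (f.2.1 1 a.unop)
    refine (coindVal_smul _ f.1 1).trans ?_
    rw [mul_one, one_mul]
    rfl

theorem coindCounit_injective (N : ModuleCat.{max u v} (𝒜 0)ᵐᵒᵖ) :
    Function.Injective (coindCounit.{u, v, w} N) := by
  rw [injective_iff_map_eq_zero]
  rintro ⟨f, hf⟩ h0
  refine Subtype.ext (coind_ext fun r => ?_)
  change coindVal 𝒜 N f 1 = 0 at h0
  change coindVal 𝒜 N f r = 0
  induction r using DirectSum.Decomposition.inductionOn 𝒜 with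
  | zero => simp
  | @homogeneous τ m =>
    by_cases hτ : τ = 0
    · subst hτ
      have := hf.1 1 m
      rw [one_mul, h0, smul_zero] at this
      simpa using this
    · simpa using hf.2 τ (by simpa using hτ) m m.2
  | add r r' h h' => simp_all

/-- The additive map `r ↦ n r₀`, where `r₀` is the component of degree zero of `r`. -/
def smulProjZero (N : Type v) [AddCommGroup N] [Module (𝒜 0)ᵐᵒᵖ N] (n : N) : R →+ N :=
  AddMonoidHom.mk' (fun r => MulOpposite.op (DirectSum.decompose 𝒜 r 0) • n)
    fun r r' => by simp [add_smul]

theorem smulProjZero_mem_coindPart (N : Type v) [AddCommGroup N] [Module (𝒜 0)ᵐᵒᵖ N] (n : N) :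
    smulProjZero (𝒜 := 𝒜) N n ∈ coindPart 𝒜 N 0 := by
  refine ⟨fun r a => ?_, fun τ hτ r hr => ?_⟩
  · have : DirectSum.decompose 𝒜 (r * a) 0 = DirectSum.decompose 𝒜 r 0 * a := Subtype.ext <| by
      have := DirectSum.coe_decompose_mul_add_of_right_mem (𝒜 := 𝒜) (i := 0) (a := r) a.2
      rwa [add_zero] at this
    change MulOpposite.op (DirectSum.decompose 𝒜 (r * a) 0) • n =
      MulOpposite.op a • MulOpposite.op (DirectSum.decompose 𝒜 r 0) • n
    rw [this, MulOpposite.op_mul, mul_smul]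
  · have : DirectSum.decompose 𝒜 r 0 = 0 :=
      Subtype.ext (DirectSum.decompose_of_mem_ne 𝒜 hr (by simpa using hτ))
    simp [smulProjZero, this]

theorem coindCounit_surjective (N : ModuleCat.{max u v} (𝒜 0)ᵐᵒᵖ) :
    Function.Surjective (coindCounit.{u, v, w} N) := fun n => by
  have h := smulProjZero_mem_coindPart (𝒜 := 𝒜) N n
  refine ⟨⟨⟨smulProjZero N n, AddSubgroup.mem_iSup_of_mem 0 h⟩, h⟩, ?_⟩
  change MulOpposite.op (DirectSum.decompose 𝒜 (1 : R) 0) • n = n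
  have : DirectSum.decompose 𝒜 (1 : R) 0 = 1 :=
    Subtype.ext (DirectSum.decompose_of_mem_same 𝒜 SetLike.GradedOne.one_mem)
  rw [this, MulOpposite.op_one, one_smul]

variable {N : ModuleCat.{max u v} (𝒜 0)ᵐᵒᵖ} {X : GrMod.{u, max u v, w} 𝒜}

/-- The additive map `r ↦ g((x r)₀)` determined by a map `g : X₀ → N` and an element `x`. -/
noncomputable def coindLiftFun (g : X.grade 0 →ₗ[(𝒜 0)ᵐᵒᵖ] N) (x : X.carrier) : R →+ N :=
  AddMonoidHom.mk' (fun r => g (X.gradeProj 0 (MulOpposite.op r • x)))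
    fun r r' => by rw [MulOpposite.op_add, add_smul, map_add, map_add]

theorem coindLiftFun_apply (g : X.grade 0 →ₗ[(𝒜 0)ᵐᵒᵖ] N) (x : X.carrier) (r : R) :
    coindLiftFun g x r = g (X.gradeProj 0 (MulOpposite.op r • x)) := rfl

theorem coindLiftFun_mem_part (g : X.grade 0 →ₗ[(𝒜 0)ᵐᵒᵖ] N) {σ : ι} {x : X.carrier}
    (hx : x ∈ X.grade σ) : coindLiftFun g x ∈ coindPart 𝒜 N σ := by
  refine ⟨fun r a => ?_, fun τ hτ r hr => ?_⟩
  · rw [coindLiftFun_apply, coindLiftFun_apply, ← map_smul]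
    refine congrArg g (Subtype.ext ?_)
    rw [MulOpposite.op_mul, mul_smul, gradeProj_smul_zero, coe_gradeZero_smul]
    rfl
  · rw [coindLiftFun_apply, gradeProj_ne (X.smul_mem hx hr), map_zero]
    exact fun h => hτ (neg_eq_of_add_eq_zero_right h).symm

theorem coindLiftFun_mem (g : X.grade 0 →ₗ[(𝒜 0)ᵐᵒᵖ] N) (x : X.carrier) :
    coindLiftFun g x ∈ coindSubgroup 𝒜 N := by
  induction x using homogeneous_induction with
  | zero =>
    convert zero_mem (coindSubgroup 𝒜 N)
    ext; simp [coindLiftFun_apply]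
  | homogeneous σ x hx => exact AddSubgroup.mem_iSup_of_mem σ (coindLiftFun_mem_part g hx)
  | add x y hx hy =>
    convert add_mem hx hy
    ext; simp [coindLiftFun_apply]

/-- The morphism `x ↦ (r ↦ g((x r)₀))` of graded modules determined by a map `g : X₀ → N`. -/
noncomputable def coindLift (g : X.grade 0 →ₗ[(𝒜 0)ᵐᵒᵖ] N) : X ⟶ (Coind.{u, v, w} 𝒜).obj N where
  toLin :=
    { toFun := fun x => (⟨coindLiftFun g x, coindLiftFun_mem g x⟩ : CoindCarrier 𝒜 N)
      map_add' := fun x y => coind_ext fun r => by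
        change g _ = g _ + g _
        rw [smul_add, map_add, map_add]
      map_smul' := fun s x => coind_ext fun r => by
        change g _ = g _
        rw [← mul_smul]
        rfl }
  map_mem _ _ hx := coindLiftFun_mem_part g hx

theorem coindVal_coindLift (g : X.grade 0 →ₗ[(𝒜 0)ᵐᵒᵖ] N) (x : X.carrier) (r : R) :
    coindVal 𝒜 N ((coindLift.{u, v, w} g).toLin x) r = g (X.gradeProj 0 (MulOpposite.op r • x)) :=
  rfl

/-- An element of the coinduced module and its component of degree zero agree at `1`. -/
theorem coindCounit_gradeProj (f : ((Coind.{u, v, w} 𝒜).obj N).carrier) :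
    coindCounit.{u, v, w} N (((Coind.{u, v, w} 𝒜).obj N).gradeProj 0 f) = coindVal 𝒜 N f 1 := by
  induction f using homogeneous_induction with
  | zero => rw [map_zero, map_zero]; rfl
  | homogeneous σ f hf =>
    by_cases h : σ = 0
    · subst h
      exact congrArg (fun t => coindVal 𝒜 N t 1) (gradeProj_same hf)
    · rw [gradeProj_ne hf h, map_zero]
      exact (hf.2 0 (fun h' => h (by simpa using h'.symm)) 1 SetLike.GradedOne.one_mem).symm
  | add f f' h h' => rw [map_add, map_add, h, h']; rfl

/-- The adjunction between the functor taking the component of degree zero and the coinduced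
functor. -/
noncomputable def coindAdjunction (𝒜 : ι → AddSubgroup R) [GradedRing 𝒜] :
    gradeZero.{u, max u v, w} 𝒜 ⊣ Coind.{u, v, w} 𝒜 :=
  Adjunction.mkOfHomEquiv
    { homEquiv := fun X N =>
        { toFun := fun g => coindLift g.hom
          invFun := fun f => ModuleCat.ofHom ((coindCounit N).comp (gradeZeroMap f))
          left_inv := fun g => ModuleCat.hom_ext <| LinearMap.ext fun x => by
            change g.hom (X.gradeProj 0 (MulOpposite.op (1 : R) • (x : X.carrier))) = g.hom x
            refine congrArg g.hom (Subtype.ext ?_)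
            rw [MulOpposite.op_one, one_smul, gradeProj_same x.2]
          right_inv := fun f => hom_ext <| LinearMap.ext fun x => coind_ext fun r => by
            refine (coindVal_coindLift _ x r).trans ?_
            have h : gradeZeroMap f (X.gradeProj 0 (MulOpposite.op r • x)) =
                ((Coind.{u, v, w} 𝒜).obj N).gradeProj 0 (MulOpposite.op r • f.toLin x) := by
              rw [← map_smul f.toLin]
              exact Subtype.ext (map_gradeProj f 0 _)
            refine (congrArg (coindCounit N) h).trans ((coindCounit_gradeProj _).trans ?_)
            exact congrArg (coindVal 𝒜 N (f.toLin x)) (mul_one r) }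
      homEquiv_naturality_left_symm := fun f g => rfl
      homEquiv_naturality_right := fun f g => rfl }

/-- The coinduced functor is fully faithful, since the counit of its adjunction is evaluation at
`1`, an isomorphism `Coind(N)₀ ≅ N`. -/
noncomputable def coindFullyFaithful (𝒜 : ι → AddSubgroup R) [GradedRing 𝒜] :
    (Coind.{u, v, w} 𝒜).FullyFaithful := by
  have (N : ModuleCat.{max u v} (𝒜 0)ᵐᵒᵖ) : IsIso ((coindAdjunction.{u, v, w} 𝒜).counit.app N) :=
    (ConcreteCategory.isIso_iff_bijective _).mpr
      ⟨coindCounit_injective.{u, v, w} N, coindCounit_surjective.{u, v, w} N⟩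
  have : IsIso (coindAdjunction.{u, v, w} 𝒜).counit := NatIso.isIso_of_isIso_app _
  exact (coindAdjunction.{u, v, w} 𝒜).fullyFaithfulROfIsIsoCounit

end Coind

/-- The induced functor is fully faithful: it is the other end of an adjoint triple whose right
end, the coinduced functor, is fully faithful. -/
noncomputable def indFullyFaithful (𝒜 : ι → AddSubgroup R) [GradedRing 𝒜] :
    (Ind.{u, v, w} 𝒜).FullyFaithful :=
  (Adjunction.Triple.mk (indAdjunction.{u, v, w} 𝒜)
    (coindAdjunction.{u, v, w} 𝒜)).fullyFaithfulEquiv.symm (coindFullyFaithful.{u, v, w} 𝒜)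

end GrMod

end GradedModules

theorem mainTheorem9 {G : Type w} [Group G] [DecidableEq G] {R : Type u} [Ring R]
    (𝒜 : Additive G → AddSubgroup R) [GradedRing 𝒜]
    (M N : ModuleCat.{max u v} (𝒜 0)ᵐᵒᵖ) :
    (IsCSRickart M N ↔
      IsCSRickart ((GrMod.Coind.{u, v, w} 𝒜).obj M) ((GrMod.Coind.{u, v, w} 𝒜).obj N)) ∧
    (IsDualCSRickart M N ↔
      IsDualCSRickart ((GrMod.Ind.{u, v, w} 𝒜).obj M) ((GrMod.Ind.{u, v, w} 𝒜).obj N)) := by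
  have := (GrMod.coindFullyFaithful.{u, v, w} 𝒜).full
  have := (GrMod.coindFullyFaithful.{u, v, w} 𝒜).faithful
  have := (GrMod.indFullyFaithful.{u, v, w} 𝒜).full
  have := (GrMod.indFullyFaithful.{u, v, w} 𝒜).faithful
  have := (GrMod.gradeZero 𝒜).preservesMonomorphisms_of_adjunction
    (GrMod.indAdjunction.{u, v, w} 𝒜)
  have := (GrMod.gradeZero 𝒜).preservesEpimorphisms_of_adjunction
    (GrMod.coindAdjunction.{u, v, w} 𝒜)
  exact ⟨(isCSRickart_map_iff (GrMod.coindAdjunction.{u, v, w} 𝒜) M N).symm,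
    (isDualCSRickart_map_iff (GrMod.indAdjunction.{u, v, w} 𝒜) M N).symm⟩
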